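/- Let $d\in\mathbb N$. A ranking of $[d]=\{1,\dots,d\}$ is a function $r:[d]\to[d]$ such that $\#\{b : r(b)<r(a)\}=r(a)-1$ for every $a\in[d]$ (ties are allowed); let $\mathcal R$ be the set of all rankings of $[d]$. For $x\in\mathbb R^d$ let $rk(x)\in\mathcal R$ be the ranking given by $rk(x)(i)=\#\{j : x_j>x_i\}+1$. For each $r\in\mathcal R$ let $\mu^r$ be a probability distribution on $\mathbb R^d$ with finite second moments. A ranking-based process with initial distribution $\nu$ is a time-homogeneous Markov process $(X_n)_{n\ge 0}$ in $\mathbb R^d$, adapted to (and Markov with respect to) a filtration on a probability space, such that $X_0\sim\nu$ and the transition kernel is $\mu(x,B)=\mu^{rk(x)}(B-x)$, where $B-x=\{y\in\mathbb R^d : y+x\in B\}$; write $\mathbb P_\nu$ for the corresponding probability. Initial distributions are always assumed to be probability distributions with finite second moments. Let $\{rk(X_n)\to r\}$ be the event that $rk(X_n)=r$ for all sufficiently large $n$, and call a ranking $r$ terminal if $\mathbb P_\nu(rk(X_n)\to r)>0$ for some initial distribution $\nu$. Proposition. Suppose that for every permutation $\sigma$ of $[d]$ and every $r'\in\mathcal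 R$, $$\mu^{r'}\bigl(\{x\in\mathbb R^d : x_{\sigma_1}>x_{\sigma_2}\ge x_{\sigma_3}\ge\dots\ge x_{\sigma_d}\}\bigr)>0 .$$ Then for every initial distribution $\nu$ and every terminal ranking $r$, $$\mathbb P_\nu(rk(X_n)\to r)>0 .$$ -/

import Mathlib

open MeasureTheory ProbabilityTheory Set

universe u v

/-- A ranking of `{1, …, d}`: a function `r` with positions in `{1, …, d}` such that exactly
`r a - 1` elements have a smaller position than `a`. Ties are allowed. -/
@[ext]
structure Ranking (d : ℕ) where
  /-- The position of an element; position `1` is the highest. -/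
  pos : Fin d → ℕ
  one_le_pos : ∀ a, 1 ≤ pos a
  pos_le : ∀ a, pos a ≤ d
  card_lt : ∀ a, (Finset.univ.filter fun b => pos b < pos a).card = pos a - 1

instance Ranking.instFinite (d : ℕ) : Finite (Ranking d) := by
  refine Finite.of_injective
    (fun (r : Ranking d) (a : Fin d) => (⟨r.pos a, Nat.lt_succ_of_le (r.pos_le a)⟩ : Fin (d + 1)))
    ?_
  intro r s h
  ext a
  exact congrArg Fin.val (congrFun h a)

/-- The set of rankings carries the discrete σ-algebra. -/
instance Ranking.instMeasurableSpace (d : ℕ) : MeasurableSpace (Ranking d) := ⊤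

instance Ranking.instDiscreteMeasurableSpace (d : ℕ) : DiscreteMeasurableSpace (Ranking d) :=
  ⟨fun _ => trivial⟩

/-- The position of the `i`-th component of `x`: one plus the number of larger components. -/
noncomputable def rkPos {d : ℕ} (x : Fin d → ℝ) (i : Fin d) : ℕ :=
  (Finset.univ.filter fun j => x i < x j).card + 1

theorem rkPos_lt_rkPos_iff {d : ℕ} (x : Fin d → ℝ) (i j : Fin d) :
    rkPos x i < rkPos x j ↔ x j < x i := by
  unfold rkPos
  constructor
  · intro h
    by_contra! hle
    have : (Finset.univ.filter fun k => x j < x k).card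
        ≤ (Finset.univ.filter fun k => x i < x k).card := by
      apply Finset.card_le_card
      intro k hk
      simp only [Finset.mem_filter, Finset.mem_univ, true_and] at hk ⊢
      exact lt_of_le_of_lt hle hk
    omega
  · intro h
    have : (Finset.univ.filter fun k => x i < x k).card
        < (Finset.univ.filter fun k => x j < x k).card := by
      apply Finset.card_lt_card
      rw [Finset.ssubset_iff_of_subset]
      · exact ⟨i, by simpa using h, by simp⟩
      · intro k hk
        simp only [Finset.mem_filter, Finset.mem_univ, true_and] at hk ⊢
        exact h.trans hk
    omega

/-- The ranking `rk x` of the components of a vector `x` (standard competition ranking). -/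
noncomputable def rk {d : ℕ} (x : Fin d → ℝ) : Ranking d where
  pos := rkPos x
  one_le_pos a := Nat.le_add_left 1 _
  pos_le a := by
    have h : (Finset.univ.filter fun j => x a < x j).card < (Finset.univ : Finset (Fin d)).card :=
      Finset.card_lt_card (Finset.filter_ssubset.2 ⟨a, Finset.mem_univ a, lt_irrefl _⟩)
    rw [Finset.card_univ, Fintype.card_fin] at h
    exact h
  card_lt a := by
    simp only [rkPos_lt_rkPos_iff]
    simp [rkPos]

theorem measurable_rk {d : ℕ} : Measurable (rk : (Fin d → ℝ) → Ranking d) := by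
  refine measurable_to_countable' fun r => ?_
  have h : (rk ⁻¹' {r} : Set (Fin d → ℝ)) = ⋂ i, {x | rkPos x i = r.pos i} := by
    ext x
    simp only [mem_preimage, mem_singleton_iff, mem_iInter, mem_ofPred_eq]
    constructor
    · rintro rfl i
      rfl
    · intro h
      exact Ranking.ext (funext h)
  rw [h]
  refine MeasurableSet.iInter fun i => ?_
  have hm : Measurable fun x : Fin d → ℝ => rkPos x i := by
    unfold rkPos
    simp only [Finset.card_filter]
    refine Measurable.add_const (Finset.measurable_sum _ fun j _ => ?_) 1
    exact Measurable.ite (measurableSet_lt (measurable_pi_apply i) (measurable_pi_apply j))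
      measurable_const measurable_const
  exact hm (measurableSet_singleton _)

/-- A distribution on `ℝ^d` has finite second moments: every coordinate is square integrable. -/
def FiniteSecondMoments {d : ℕ} (ρ : Measure (Fin d → ℝ)) : Prop :=
  ∀ i, Integrable (fun x : Fin d → ℝ => x i ^ 2) ρ

/-- The transition kernel `μ(x, B) = μ^{rk x}(B - x)`, where `B - x = {y | y + x ∈ B}`. -/
noncomputable def transitionKernel {d : ℕ} (μ : Ranking d → Measure (Fin d → ℝ))
    [∀ r, IsProbabilityMeasure (μ r)] : Kernel (Fin d → ℝ) (Fin d → ℝ) where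
  toFun x := (μ (rk x)).map fun y => y + x
  measurable' := by
    refine Measure.measurable_of_measurable_coe _ fun B hB => ?_
    have h1 : (fun x : Fin d → ℝ => ((μ (rk x)).map fun y => y + x) B)
        = (fun p : Ranking d × (Fin d → ℝ) => μ p.1 {y | y + p.2 ∈ B}) ∘ fun x => (rk x, x) :=
      funext fun x => Measure.map_apply (measurable_add_const x) hB
    rw [h1]
    refine Measurable.comp (measurable_from_prod_countable_right fun r => ?_)
      (measurable_rk.prodMk measurable_id)
    have hS : MeasurableSet {p : (Fin d → ℝ) × (Fin d → ℝ) | p.2 + p.1 ∈ B} :=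
      (measurable_snd.add measurable_fst) hB
    exact measurable_measure_prodMk_left (ν := μ r) hS

theorem transitionKernel_apply {d : ℕ} (μ : Ranking d → Measure (Fin d → ℝ))
    [∀ r, IsProbabilityMeasure (μ r)] (x : Fin d → ℝ) {B : Set (Fin d → ℝ)}
    (hB : MeasurableSet B) : transitionKernel μ x B = μ (rk x) {y | y + x ∈ B} :=
  Measure.map_apply (measurable_add_const x) hB

/-- `X` is a ranking-based process on the filtered probability space `(Ω, 𝓕, P)` with increment
distributions `μ` and initial distribution `ν`: an adapted, time-homogeneous Markov process
with respect to `𝓕`, with transition kernel `transitionKernel μ` and with `X 0 ∼ ν`. -/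
structure IsRankingBasedProcess {d : ℕ} (μ : Ranking d → Measure (Fin d → ℝ))
    [∀ r, IsProbabilityMeasure (μ r)] (ν : Measure (Fin d → ℝ))
    {Ω : Type u} {mΩ : MeasurableSpace Ω} (P : Measure Ω) (𝓕 : Filtration ℕ mΩ)
    (X : ℕ → Ω → Fin d → ℝ) : Prop where
  isProbabilityMeasure : IsProbabilityMeasure P
  adapted : Adapted 𝓕 X
  initial : P.map (X 0) = ν
  markov : ∀ (n : ℕ) (B : Set (Fin d → ℝ)), MeasurableSet B →
    P⟦X (n + 1) ⁻¹' B | 𝓕 n⟧ =ᵐ[P] fun ω => (transitionKernel μ (X n ω)).real B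

/-- The event `{rk(X_n) → r}` that the ranking equals `r` for all sufficiently large `n`. -/
def rankingConvergesTo {d : ℕ} {Ω : Type u} (X : ℕ → Ω → Fin d → ℝ) (r : Ranking d) : Set Ω :=
  {ω | ∃ n₀ : ℕ, ∀ n, n₀ ≤ n → rk (X n ω) = r}

/-- The ranking `r` is terminal for the transition kernel given by `μ`: for some initial
distribution `ν` (with finite second moments) one has `P_ν(rk(X_n) → r) > 0`. The law of the
process is determined by `ν` and `μ`, so the choice of the underlying filtered probability
space (and of its universe) is immaterial. -/
def IsTerminal {d : ℕ} (μ : Ranking d → Measure (Fin d → ℝ)) [∀ r, IsProbabilityMeasure (μ r)]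
    (r : Ranking d) : Prop :=
  ∃ ν : Measure (Fin d → ℝ), IsProbabilityMeasure ν ∧ FiniteSecondMoments ν ∧
    ∃ (Ω : Type u) (mΩ : MeasurableSpace Ω) (P : Measure Ω) (𝓕 : Filtration ℕ mΩ)
      (X : ℕ → Ω → Fin d → ℝ),
      IsRankingBasedProcess μ ν P 𝓕 X ∧ 0 < P (rankingConvergesTo X r)

/-- The set of `x` with `x_{σ 1} > x_{σ 2} ≥ x_{σ 3} ≥ … ≥ x_{σ d}` (indices start at `0` in the
code; for `d ≤ 1` there is no constraint). -/
def leaderSet {d : ℕ} (σ : Equiv.Perm (Fin d)) : Set (Fin d → ℝ) :=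
  {x | (∀ k l : Fin d, k.val = 0 → l.val = 1 → x (σ k) > x (σ l)) ∧
    ∀ k l : Fin d, 1 ≤ k.val → l.val = k.val + 1 → x (σ k) ≥ x (σ l)}

/-! ### The transition kernel and the one-step Markov property. -/

open scoped ENNReal

/-! Let `h x = ⨅ N, stayProb μ r N x`, the probability of keeping the ranking `r` forever from `x`.
If `r` is terminal, `h x > 0` for some `x`, since there are only countably many times from which the
ranking can be constant.

A terminal `r` has no ties: a tie survives a step only if both tied elements receive equal
increments, and positivity of the leader sets makes this event have probability below one, so `h`
would vanish (`IsTerminal.pos_injective`).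

As long as the ranking is `r`, increments have the law `μ r` wherever the process is. Running two
copies with the same increments shows that `h` is monotone in the gaps (`stayProb_le_of_gaps_le`),
so `h ≥ h x` wherever all gaps are at least some `K`.

Such points are reached with positive probability from any `ν`: gaps are built from the bottom of
`r` upwards, each element in turn being pulled ahead of those behind it without shrinking the gaps
among the latter (`exists_measure_gaps_pos`). The Markov property combines the two facts. -/

instance transitionKernel.instIsMarkovKernel {d : ℕ} (μ : Ranking d → Measure (Fin d → ℝ))
    [∀ r, IsProbabilityMeasure (μ r)] : IsMarkovKernel (transitionKernel μ) :=
  ⟨fun x => ⟨by rw [transitionKernel_apply μ x MeasurableSet.univ]; simp⟩⟩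

theorem lintegral_transitionKernel {d : ℕ} (μ : Ranking d → Measure (Fin d → ℝ))
    [∀ r, IsProbabilityMeasure (μ r)] (x : Fin d → ℝ) {f : (Fin d → ℝ) → ℝ≥0∞}
    (hf : Measurable f) :
    ∫⁻ y, f y ∂(transitionKernel μ x) = ∫⁻ z, f (z + x) ∂(μ (rk x)) :=
  lintegral_map hf (measurable_add_const x)

theorem IsRankingBasedProcess.measurable {d : ℕ} {μ : Ranking d → Measure (Fin d → ℝ)}
    [∀ r, IsProbabilityMeasure (μ r)] {ν : Measure (Fin d → ℝ)} {Ω : Type u}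
    {mΩ : MeasurableSpace Ω} {P : Measure Ω} {𝓕 : Filtration ℕ mΩ} {X : ℕ → Ω → Fin d → ℝ}
    (hX : IsRankingBasedProcess μ ν P 𝓕 X) (n : ℕ) : Measurable (X n) :=
  (hX.adapted n).mono (𝓕.le n) le_rfl

/-- The Markov property in integrated form. -/
theorem IsRankingBasedProcess.setLIntegral_succ {d : ℕ} {μ : Ranking d → Measure (Fin d → ℝ)}
    [∀ r, IsProbabilityMeasure (μ r)] {ν : Measure (Fin d → ℝ)} {Ω : Type u}
    {mΩ : MeasurableSpace Ω} {P : Measure Ω} {𝓕 : Filtration ℕ mΩ} {X : ℕ → Ω → Fin d → ℝ}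
    (hX : IsRankingBasedProcess μ ν P 𝓕 X) {n : ℕ} {F : Set Ω} (hF : MeasurableSet[𝓕 n] F)
    {f : (Fin d → ℝ) → ℝ≥0∞} (hf : Measurable f) :
    ∫⁻ ω in F, f (X (n + 1) ω) ∂P
      = ∫⁻ ω in F, ∫⁻ y, f y ∂(transitionKernel μ (X n ω)) ∂P := by
  have := hX.isProbabilityMeasure
  have hm := hX.measurable
  have hF' : MeasurableSet F := 𝓕.le n F hF
  -- An identity of measures: checked on sets, where the Markov property applies, it extends to
  -- every measurable `f`.
  have key : (P.restrict F).map (X (n + 1))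
      = ((P.restrict F).map (X n)).bind (transitionKernel μ) := by
    ext B hB
    rw [Measure.bind_apply hB (transitionKernel μ).aemeasurable,
      lintegral_map ((transitionKernel μ).measurable_coe hB) (hm n),
      Measure.map_apply (hm _) hB]
    have hK : Measurable fun ω => transitionKernel μ (X n ω) B :=
      ((transitionKernel μ).measurable_coe hB).comp (hm n)
    have hBm : MeasurableSet (X (n + 1) ⁻¹' B) := hm _ hB
    have h1 : ∫ ω in F, (transitionKernel μ (X n ω)).real B ∂P
        = (P.restrict F).real (X (n + 1) ⁻¹' B) := by
      rw [← setIntegral_congr_ae hF' ((hX.markov n B hB).mono fun ω h _ => h),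
        setIntegral_condExp (𝓕.le n) ((integrable_const (1 : ℝ)).indicator hBm) hF,
        integral_indicator hBm]
      simp
    have h2 : ∫ ω in F, (transitionKernel μ (X n ω)).real B ∂P
        = (∫⁻ ω in F, transitionKernel μ (X n ω) B ∂P).toReal :=
      integral_toReal hK.aemeasurable (ae_of_all _ fun ω => measure_lt_top _ _)
    have h3 : ∫⁻ ω in F, transitionKernel μ (X n ω) B ∂P ≠ ∞ := by
      refine ne_top_of_le_ne_top (measure_ne_top P F) ?_
      calc ∫⁻ ω in F, transitionKernel μ (X n ω) B ∂P ≤ ∫⁻ _ in F, 1 ∂P :=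
            lintegral_mono fun ω => prob_le_one
        _ = P F := by simp
    exact (ENNReal.toReal_eq_toReal_iff' (measure_ne_top _ _) h3).1 (h1.symm.trans h2)
  rw [← lintegral_map hf (hm _), key, Measure.lintegral_bind (transitionKernel μ).aemeasurable
    hf.aemeasurable, lintegral_map hf.lintegral_kernel (hm n)]

/-! ### Probabilities of keeping a ranking. -/

/-- The probability, started at a given point, that the ranking is `r` at the times `0, …, N`. -/
noncomputable def stayProb {d : ℕ} (μ : Ranking d → Measure (Fin d → ℝ))
    [∀ r, IsProbabilityMeasure (μ r)] (r : Ranking d) : ℕ → (Fin d → ℝ) → ℝ≥0∞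
  | 0 => {y | rk y = r}.indicator 1
  | N + 1 => {y | rk y = r}.indicator fun y => ∫⁻ z, stayProb μ r N z ∂(transitionKernel μ y)

section stayProb

variable {d : ℕ} (μ : Ranking d → Measure (Fin d → ℝ)) [∀ r, IsProbabilityMeasure (μ r)]
  (r : Ranking d)

theorem measurableSet_rk_eq : MeasurableSet {y : Fin d → ℝ | rk y = r} :=
  measurable_rk (measurableSet_singleton r)

theorem measurable_stayProb (N : ℕ) : Measurable (stayProb μ r N) := by
  induction N with
  | zero => exact measurable_one.indicator (measurableSet_rk_eq r)
  | succ N ih => exact ih.lintegral_kernel.indicator (measurableSet_rk_eq r)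

theorem stayProb_of_rk_ne {y : Fin d → ℝ} (hy : rk y ≠ r) (N : ℕ) : stayProb μ r N y = 0 := by
  cases N <;> exact indicator_of_notMem (s := {y | rk y = r}) hy _

theorem stayProb_zero_of_rk_eq {y : Fin d → ℝ} (hy : rk y = r) : stayProb μ r 0 y = 1 :=
  indicator_of_mem (s := {y | rk y = r}) hy _

theorem stayProb_succ_of_rk_eq {y : Fin d → ℝ} (hy : rk y = r) (N : ℕ) :
    stayProb μ r (N + 1) y = ∫⁻ z, stayProb μ r N (z + y) ∂(μ r) := by
  rw [stayProb, indicator_of_mem (s := {y | rk y = r}) hy,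
    lintegral_transitionKernel μ y (measurable_stayProb μ r N), hy]

theorem stayProb_le_one (N : ℕ) (y : Fin d → ℝ) : stayProb μ r N y ≤ 1 := by
  by_cases hy : rk y = r
  · induction N generalizing y with
    | zero => exact (stayProb_zero_of_rk_eq μ r hy).le
    | succ N ih =>
      rw [stayProb_succ_of_rk_eq μ r hy]
      calc ∫⁻ z, stayProb μ r N (z + y) ∂(μ r) ≤ ∫⁻ _, 1 ∂(μ r) := by
            refine lintegral_mono fun z => ?_
            by_cases hz : rk (z + y) = r
            · exact ih _ hz
            · simp [stayProb_of_rk_ne μ r hz]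
        _ = 1 := by simp
  · simp [stayProb_of_rk_ne μ r hy]

theorem stayProb_succ_le (N : ℕ) (y : Fin d → ℝ) : stayProb μ r (N + 1) y ≤ stayProb μ r N y := by
  induction N generalizing y with
  | zero =>
    by_cases hy : rk y = r
    · rw [stayProb_zero_of_rk_eq μ r hy]
      exact stayProb_le_one μ r _ _
    · simp [stayProb_of_rk_ne μ r hy]
  | succ N ih =>
    by_cases hy : rk y = r
    · rw [stayProb_succ_of_rk_eq μ r hy, stayProb_succ_of_rk_eq μ r hy]
      exact lintegral_mono fun z => ih _
    · simp [stayProb_of_rk_ne μ r hy]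

theorem rk_eq_iff_of_injective (hr : Function.Injective r.pos) (x : Fin d → ℝ) :
    rk x = r ↔ ∀ a b, r.pos a < r.pos b → x b < x a := by
  constructor
  · rintro rfl a b h
    exact (rkPos_lt_rkPos_iff x a b).1 h
  · intro h
    have hiff : ∀ a b, r.pos a < r.pos b ↔ x b < x a := by
      refine fun a b => ⟨h a b, fun hx => ?_⟩
      rcases lt_trichotomy (r.pos a) (r.pos b) with h1 | h1 | h1
      · exact h1
      · exact absurd hx (by rw [hr h1]; exact lt_irrefl _)
      · exact absurd hx (h b a h1).not_gt
    ext a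
    have h1 := r.card_lt a
    have h2 := r.one_le_pos a
    simp only [hiff] at h1
    change (Finset.univ.filter fun j => x a < x j).card + 1 = r.pos a
    omega

/-- Increasing the gaps in the direction of `r` increases the probability to keep the ranking. -/
theorem stayProb_le_of_gaps_le (hr : Function.Injective r.pos) (N : ℕ) {x y : Fin d → ℝ}
    (hxy : ∀ a b, r.pos a < r.pos b → x a - x b ≤ y a - y b) :
    stayProb μ r N x ≤ stayProb μ r N y := by
  by_cases hx : rk x = r
  · have hy : rk y = r := by
      rw [rk_eq_iff_of_injective r hr] at hx ⊢
      intro a b hab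
      linarith [hx a b hab, hxy a b hab]
    induction N generalizing x y with
    | zero => rw [stayProb_zero_of_rk_eq μ r hx, stayProb_zero_of_rk_eq μ r hy]
    | succ N ih =>
      rw [stayProb_succ_of_rk_eq μ r hx, stayProb_succ_of_rk_eq μ r hy]
      refine lintegral_mono fun z => ?_
      -- Coupling: the same increment `z` drives both copies. If the copy from `x` leaves `r`, the
      -- left integrand is zero.
      have hz : ∀ a b, r.pos a < r.pos b → (z + x) a - (z + x) b ≤ (z + y) a - (z + y) b := by
        intro a b hab
        simp only [Pi.add_apply]
        linarith [hxy a b hab]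
      by_cases hzx : rk (z + x) = r
      · refine ih hz hzx ?_
        rw [rk_eq_iff_of_injective r hr] at hzx ⊢
        intro a b hab
        linarith [hzx a b hab, hz a b hab]
      · simp [stayProb_of_rk_ne μ r hzx]
  · simp [stayProb_of_rk_ne μ r hx]

/-- Ties before and after a step force equal increments on `a` and `b`; the times `0, …, N` contain
`N` steps. -/
theorem stayProb_le_pow_of_tie {a b : Fin d} (hab : r.pos a = r.pos b) (N : ℕ) (y : Fin d → ℝ) :
    stayProb μ r N y ≤ μ r {z | z a = z b} ^ N := by
  have tie : ∀ x : Fin d → ℝ, rk x = r → x a = x b := by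
    rintro x rfl
    have h1 := rkPos_lt_rkPos_iff x a b
    have h2 := rkPos_lt_rkPos_iff x b a
    have h3 : rkPos x a = rkPos x b := hab
    rw [h3] at h1 h2
    simp only [lt_irrefl, false_iff, not_lt] at h1 h2
    exact le_antisymm h1 h2
  have hm : MeasurableSet {z : Fin d → ℝ | z a = z b} :=
    measurableSet_eq_fun (measurable_pi_apply a) (measurable_pi_apply b)
  induction N generalizing y with
  | zero => simpa using stayProb_le_one μ r 0 y
  | succ N ih =>
    by_cases hy : rk y = r
    · rw [stayProb_succ_of_rk_eq μ r hy]
      calc ∫⁻ z, stayProb μ r N (z + y) ∂(μ r)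
          ≤ ∫⁻ z, {z : Fin d → ℝ | z a = z b}.indicator
              (fun _ => μ r {z | z a = z b} ^ N) z ∂(μ r) := by
            refine lintegral_mono fun z => ?_
            by_cases hz : rk (z + y) = r
            · have h1 := tie _ hz
              have h2 := tie _ hy
              simp only [Pi.add_apply, h2, add_left_inj] at h1
              rw [indicator_of_mem (s := {z : Fin d → ℝ | z a = z b}) h1]
              exact ih _
            · simp [stayProb_of_rk_ne μ r hz]
        _ = μ r {z | z a = z b} ^ (N + 1) := by
            rw [lintegral_indicator_const hm, pow_succ]
    · simp [stayProb_of_rk_ne μ r hy]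

end stayProb

/-! ### Keeping a ranking along the process. -/

theorem IsRankingBasedProcess.measure_inter_stay {d : ℕ} {μ : Ranking d → Measure (Fin d → ℝ)}
    [∀ r, IsProbabilityMeasure (μ r)] {ν : Measure (Fin d → ℝ)} {Ω : Type u}
    {mΩ : MeasurableSpace Ω} {P : Measure Ω} {𝓕 : Filtration ℕ mΩ} {X : ℕ → Ω → Fin d → ℝ}
    (hX : IsRankingBasedProcess μ ν P 𝓕 X) (r : Ranking d) (N n : ℕ) {F : Set Ω}
    (hF : MeasurableSet[𝓕 n] F) :
    P (F ∩ {ω | ∀ m ≤ N, rk (X (n + m) ω) = r}) = ∫⁻ ω in F, stayProb μ r N (X n ω) ∂P := by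
  induction N generalizing n F with
  | zero =>
    have hD : MeasurableSet (X n ⁻¹' {y | rk y = r}) := hX.measurable n (measurableSet_rk_eq r)
    have h : (fun ω => stayProb μ r 0 (X n ω)) = (X n ⁻¹' {y | rk y = r}).indicator 1 := rfl
    rw [h, lintegral_indicator_one hD, Measure.restrict_apply hD, inter_comm]
    congr 2
    ext ω
    simp
  | succ N ih =>
    have hD : MeasurableSet[𝓕 n] (X n ⁻¹' {y | rk y = r}) := hX.adapted n (measurableSet_rk_eq r)
    have hFD : MeasurableSet[𝓕 n] (F ∩ X n ⁻¹' {y | rk y = r}) := hF.inter hD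
    -- The condition at time `n` is absorbed into the past event, so the induction hypothesis
    -- applies from time `n + 1`.
    have h : F ∩ {ω | ∀ m ≤ N + 1, rk (X (n + m) ω) = r}
        = (F ∩ X n ⁻¹' {y | rk y = r}) ∩ {ω | ∀ m ≤ N, rk (X (n + 1 + m) ω) = r} := by
      ext ω
      simp only [mem_inter_iff, mem_ofPred_eq, mem_preimage, and_assoc, and_congr_right_iff]
      refine fun _ => ⟨fun H => ⟨by simpa using H 0 (by omega), fun m hm => ?_⟩, fun H m hm => ?_⟩
      · have := H (m + 1) (by omega)
        rwa [show n + 1 + m = n + (m + 1) by omega]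
      · rcases m with _ | m
        · simpa using H.1
        · have := H.2 m (by omega)
          rwa [show n + (m + 1) = n + 1 + m by omega]
    have h' : (fun ω => stayProb μ r (N + 1) (X n ω)) = (X n ⁻¹' {y | rk y = r}).indicator
        fun ω => ∫⁻ z, stayProb μ r N z ∂(transitionKernel μ (X n ω)) := rfl
    rw [h, ih (n + 1) (𝓕.mono n.le_succ _ hFD),
      hX.setLIntegral_succ hFD (measurable_stayProb μ r N), h',
      lintegral_indicator (𝓕.le n _ hD), Measure.restrict_restrict (𝓕.le n _ hD), inter_comm F]

theorem IsRankingBasedProcess.measure_inter_stay_forever {d : ℕ}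
    {μ : Ranking d → Measure (Fin d → ℝ)}
    [∀ r, IsProbabilityMeasure (μ r)] {ν : Measure (Fin d → ℝ)} {Ω : Type u}
    {mΩ : MeasurableSpace Ω} {P : Measure Ω} {𝓕 : Filtration ℕ mΩ} {X : ℕ → Ω → Fin d → ℝ}
    (hX : IsRankingBasedProcess μ ν P 𝓕 X) (r : Ranking d) (n : ℕ) {F : Set Ω}
    (hF : MeasurableSet[𝓕 n] F) :
    P (F ∩ {ω | ∀ m, n ≤ m → rk (X m ω) = r})
      = ∫⁻ ω in F, ⨅ N, stayProb μ r N (X n ω) ∂P := by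
  have := hX.isProbabilityMeasure
  have hset : F ∩ {ω | ∀ m, n ≤ m → rk (X m ω) = r}
      = ⋂ N, F ∩ {ω | ∀ m ≤ N, rk (X (n + m) ω) = r} := by
    ext ω
    simp only [mem_inter_iff, mem_ofPred_eq, mem_iInter]
    refine ⟨fun H N => ⟨H.1, fun m _ => H.2 _ (by omega)⟩, fun H => ⟨(H 0).1, fun m hm => ?_⟩⟩
    have := (H (m - n)).2 (m - n) le_rfl
    rwa [Nat.add_sub_cancel' hm] at this
  have hmeas : ∀ N, MeasurableSet (F ∩ {ω | ∀ m ≤ N, rk (X (n + m) ω) = r}) := by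
    intro N
    refine (𝓕.le n _ hF).inter ?_
    simp only [ofPred_forall]
    exact MeasurableSet.iInter fun m => MeasurableSet.iInter fun _ =>
      hX.measurable _ (measurableSet_rk_eq r)
  have hanti : Antitone fun N => F ∩ {ω | ∀ m ≤ N, rk (X (n + m) ω) = r} :=
    fun N M hNM ω hω => ⟨hω.1, fun m hm => hω.2 m (hm.trans hNM)⟩
  rw [hset, hanti.measure_iInter (fun N => (hmeas N).nullMeasurableSet) ⟨0, measure_ne_top _ _⟩,
    lintegral_iInf (f := fun N ω => stayProb μ r N (X n ω))
      (fun N => (measurable_stayProb μ r N).comp (hX.measurable n))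
      (antitone_nat_of_succ_le fun N ω => stayProb_succ_le μ r N _)]
  · exact iInf_congr fun N => hX.measure_inter_stay r N n hF
  · rw [← hX.measure_inter_stay r 0 n hF]
    exact measure_ne_top _ _

/-- Otherwise each event of having ranking `r` from time `n` on would be null, and so would their
countable union. Only the point `x` is retained from the process witnessing terminality. -/
theorem IsTerminal.exists_iInf_stayProb_pos {d : ℕ} {μ : Ranking d → Measure (Fin d → ℝ)}
    [∀ r, IsProbabilityMeasure (μ r)] {r : Ranking d} (hr : IsTerminal.{v} μ r) :
    ∃ x, 0 < ⨅ N, stayProb μ r N x := by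
  obtain ⟨ν, _, _, Ω, mΩ, P, 𝓕, X, hX, hP⟩ := hr
  by_contra! hzero
  refine hP.ne' ?_
  have h : rankingConvergesTo X r = ⋃ n, univ ∩ {ω | ∀ m, n ≤ m → rk (X m ω) = r} := by
    ext ω
    simp [rankingConvergesTo]
  rw [h, measure_iUnion_null_iff]
  intro n
  rw [hX.measure_inter_stay_forever r n MeasurableSet.univ]
  simp [fun x => nonpos_iff_eq_zero.1 (hzero x)]

/-! ### Terminal rankings have no ties. -/

section leaderSet

variable {d : ℕ} {σ : Equiv.Perm (Fin d)} {z : Fin d → ℝ}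

theorem leaderSet_antitone (hz : z ∈ leaderSet σ) {k l : Fin d} (hkl : k ≤ l) :
    z (σ l) ≤ z (σ k) := by
  obtain ⟨k, hk⟩ := k
  obtain ⟨l, hl⟩ := l
  have hkl' : k ≤ l := hkl
  clear hkl
  induction l, hkl' using Nat.le_induction with
  | base => exact le_rfl
  | succ l hkl ih =>
    refine le_trans ?_ (ih (by omega))
    rcases Nat.eq_zero_or_pos l with h0 | h0
    · exact (hz.1 ⟨l, by omega⟩ ⟨l + 1, hl⟩ h0 (by simp [h0])).le
    · exact hz.2 ⟨l, by omega⟩ ⟨l + 1, hl⟩ h0 rfl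

theorem leaderSet_lt (hz : z ∈ leaderSet σ) {k l : Fin d} (hk : k.val = 0) (hl : 1 ≤ l.val) :
    z (σ l) < z (σ k) :=
  (leaderSet_antitone hz (k := ⟨1, by omega⟩) (l := l) hl).trans_lt (hz.1 k ⟨1, by omega⟩ hk rfl)

end leaderSet

theorem IsTerminal.pos_injective {d : ℕ} {μ : Ranking d → Measure (Fin d → ℝ)}
    [∀ r, IsProbabilityMeasure (μ r)]
    (hpos : ∀ (σ : Equiv.Perm (Fin d)) (r' : Ranking d), 0 < μ r' (leaderSet σ))
    {r : Ranking d} (hr : IsTerminal.{v} μ r) : Function.Injective r.pos := by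
  intro a b hab
  by_contra hne
  obtain ⟨x, hx⟩ := hr.exists_iInf_stayProb_pos
  have hd : 0 < d := a.pos
  -- Any permutation with `a` in front would do: it makes `z b < z a` on the leader set.
  set σ : Equiv.Perm (Fin d) := Equiv.swap ⟨0, hd⟩ a
  have hm : MeasurableSet {z : Fin d → ℝ | z a = z b} :=
    measurableSet_eq_fun (measurable_pi_apply a) (measurable_pi_apply b)
  have hlt : μ r {z | z a = z b} < 1 := by
    have hsub : leaderSet σ ⊆ {z : Fin d → ℝ | z a = z b}ᶜ := by
      intro z hz
      have ha : σ ⟨0, hd⟩ = a := Equiv.swap_apply_left _ _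
      have hb : σ (σ.symm b) = b := σ.apply_symm_apply b
      have hb1 : 1 ≤ (σ.symm b).val := by
        by_contra h0
        have : σ.symm b = ⟨0, hd⟩ := Fin.ext (by simpa using h0)
        rw [this, ha] at hb
        exact hne hb
      have := leaderSet_lt hz (k := ⟨0, hd⟩) rfl hb1
      rw [ha, hb] at this
      exact this.ne'
    have h1 : 0 < μ r {z : Fin d → ℝ | z a = z b}ᶜ := (hpos σ r).trans_le (measure_mono hsub)
    rw [prob_compl_eq_one_sub hm] at h1
    exact tsub_pos_iff_lt.1 h1
  have hlim := ENNReal.tendsto_pow_atTop_nhds_zero_of_lt_one hlt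
  refine hx.not_ge (ge_of_tendsto' hlim fun N => ?_)
  exact (iInf_le _ N).trans (stayProb_le_pow_of_tie μ r hab N x)

/-! ### Reaching large gaps. -/

/-- For every position `k` there is an increment, of probability bounded below, which moves the
element at position `k` ahead and does not decrease the gaps among the elements behind it. -/
theorem exists_gap_increasing_increments {d : ℕ} {μ : Ranking d → Measure (Fin d → ℝ)}
    [∀ r, IsProbabilityMeasure (μ r)]
    (hpos : ∀ (σ : Equiv.Perm (Fin d)) (r' : Ranking d), 0 < μ r' (leaderSet σ))
    {r : Ranking d} (hr : Function.Injective r.pos) {k : ℕ} (hk : 1 ≤ k) (hkd : k ≤ d) :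
    ∃ ε : ℝ, 0 < ε ∧ ∀ r', 0 < μ r' {z | (∀ a b, k ≤ r.pos a → r.pos a < r.pos b → z b ≤ z a) ∧
      ∀ a b, r.pos a = k → k < r.pos b → z b + ε ≤ z a} := by
  have hd : NeZero d := ⟨by omega⟩
  let e : Fin d → Fin d := fun a =>
    ⟨r.pos a - 1, by have := r.one_le_pos a; have := r.pos_le a; omega⟩
  have he : Function.Injective e := by
    intro a b hab
    have h1 : r.pos a - 1 = r.pos b - 1 := congrArg Fin.val hab
    have := r.one_le_pos a
    have := r.one_le_pos b
    exact hr (by omega)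
  let E : Equiv.Perm (Fin d) := Equiv.ofBijective e (Finite.injective_iff_bijective.1 he)
  -- Cyclic shift: the elements at positions `k, …, d` come first, in the order of `r`, followed by
  -- those at `1, …, k - 1`.
  let σ : Equiv.Perm (Fin d) := (Equiv.addRight (⟨k - 1, by omega⟩ : Fin d)).trans E.symm
  have hσ : ∀ a (h : k ≤ r.pos a), σ ⟨r.pos a - k, by have := r.pos_le a; omega⟩ = a := by
    intro a h
    have hle := r.pos_le a
    simp only [σ, Equiv.trans_apply, Equiv.symm_apply_eq]
    apply Fin.ext
    change (r.pos a - k + (k - 1)) % d = r.pos a - 1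
    rw [Nat.mod_eq_of_lt (by omega)]
    omega
  let S : ℕ → Set (Fin d → ℝ) := fun n =>
    {z | (∀ a b, k ≤ r.pos a → r.pos a < r.pos b → z b ≤ z a) ∧
      ∀ a b, r.pos a = k → k < r.pos b → z b + 1 / ((n : ℝ) + 1) ≤ z a}
  have hSmono : Monotone S := by
    refine fun n m hnm z hz => ⟨hz.1, fun a b ha hb => (hz.2 a b ha hb).trans' ?_⟩
    have := Nat.one_div_le_one_div (α := ℝ) hnm
    linarith
  have hsub : leaderSet σ ⊆ ⋃ n, S n := by
    intro z hz
    have hlt : ∀ a b, r.pos a = k → k < r.pos b → z b < z a := by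
      intro a b ha hb
      have := leaderSet_lt hz (k := ⟨r.pos a - k, by have := r.pos_le a; omega⟩)
        (l := ⟨r.pos b - k, by have := r.pos_le b; omega⟩) (by simp [ha])
        (show 1 ≤ r.pos b - k by omega)
      rwa [hσ a ha.ge, hσ b hb.le] at this
    have hn : ∀ p : Fin d × Fin d, ∃ n : ℕ, r.pos p.1 = k → k < r.pos p.2 →
        z p.2 + 1 / ((n : ℝ) + 1) ≤ z p.1 := by
      intro p
      by_cases h : r.pos p.1 = k ∧ k < r.pos p.2
      · obtain ⟨n, hn⟩ := exists_nat_one_div_lt (sub_pos.2 (hlt p.1 p.2 h.1 h.2))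
        exact ⟨n, fun _ _ => by linarith⟩
      · exact ⟨0, fun h1 h2 => absurd ⟨h1, h2⟩ h⟩
    choose f hf using hn
    obtain ⟨M, hM⟩ := Finite.exists_le f
    refine mem_iUnion.2 ⟨M, fun a b ha hb => ?_, fun a b ha hb => ?_⟩
    · have := leaderSet_antitone hz (k := ⟨r.pos a - k, by have := r.pos_le a; omega⟩)
        (l := ⟨r.pos b - k, by have := r.pos_le b; omega⟩)
        (show r.pos a - k ≤ r.pos b - k by omega)
      rwa [hσ a ha, hσ b (by omega)] at this
    · have h1 := hf (a, b) ha hb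
      have h2 := Nat.one_div_le_one_div (α := ℝ) (hM (a, b))
      simp only at h1
      linarith
  have hex : ∀ r', ∃ n, 0 < μ r' (S n) := by
    intro r'
    by_contra! h
    refine ((hpos σ r').trans_le (measure_mono hsub)).ne' ?_
    exact measure_iUnion_null fun n => nonpos_iff_eq_zero.1 (h n)
  -- There are finitely many rankings, so one `ε` serves them all; this matters because the current
  -- ranking is uncontrolled while gaps are being built.
  choose n hn using hex
  obtain ⟨M, hM⟩ := Finite.exists_le n
  exact ⟨1 / ((M : ℝ) + 1), Nat.one_div_pos_of_nat,
    fun r' => (hn r').trans_le (measure_mono (hSmono (hM r')))⟩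

theorem IsRankingBasedProcess.measure_succ_pos {d : ℕ} {μ : Ranking d → Measure (Fin d → ℝ)}
    [∀ r, IsProbabilityMeasure (μ r)] {ν : Measure (Fin d → ℝ)} {Ω : Type u}
    {mΩ : MeasurableSpace Ω} {P : Measure Ω} {𝓕 : Filtration ℕ mΩ} {X : ℕ → Ω → Fin d → ℝ}
    (hX : IsRankingBasedProcess μ ν P 𝓕 X) {n : ℕ} {A B : Set (Fin d → ℝ)}
    (hA : MeasurableSet A) (hB : MeasurableSet B) (hpos : 0 < P (X n ⁻¹' A))
    (hAB : ∀ y ∈ A, 0 < μ (rk y) {z | z + y ∈ B}) : 0 < P (X (n + 1) ⁻¹' B) := by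
  have hm := hX.measurable
  have h := hX.setLIntegral_succ (n := n) (F := X n ⁻¹' A) (hX.adapted n hA)
    (f := B.indicator 1) (measurable_one.indicator hB)
  simp only [lintegral_indicator_one hB] at h
  have h1 : 0 < ∫⁻ ω in X n ⁻¹' A, transitionKernel μ (X n ω) B ∂P := by
    rw [setLIntegral_pos_iff (f := fun ω => transitionKernel μ (X n ω) B)
      (((transitionKernel μ).measurable_coe hB).comp (hm n))]
    refine hpos.trans_le (measure_mono fun ω hω => ⟨?_, hω⟩)
    rw [Function.mem_support, transitionKernel_apply μ _ hB]
    exact (hAB _ hω).ne'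
  rw [← h] at h1
  have h2 : (fun ω => B.indicator (1 : (Fin d → ℝ) → ℝ≥0∞) (X (n + 1) ω))
      = (X (n + 1) ⁻¹' B).indicator 1 := rfl
  rw [h2, lintegral_indicator_one (hm _ hB)] at h1
  exact h1.trans_le (Measure.restrict_apply_le _ _)

/-- With positive probability, all gaps in the direction of `r` become as large as desired. -/
theorem IsRankingBasedProcess.exists_measure_gaps_pos {d : ℕ}
    {μ : Ranking d → Measure (Fin d → ℝ)} [∀ r, IsProbabilityMeasure (μ r)]
    (hpos : ∀ (σ : Equiv.Perm (Fin d)) (r' : Ranking d), 0 < μ r' (leaderSet σ))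
    {ν : Measure (Fin d → ℝ)} {Ω : Type u}
    {mΩ : MeasurableSpace Ω} {P : Measure Ω} {𝓕 : Filtration ℕ mΩ} {X : ℕ → Ω → Fin d → ℝ}
    (hX : IsRankingBasedProcess μ ν P 𝓕 X) {r : Ranking d} (hr : Function.Injective r.pos)
    (K : ℝ) :
    ∃ n, 0 < P (X n ⁻¹' {y | ∀ a b, r.pos a < r.pos b → K ≤ y a - y b}) := by
  have := hX.isProbabilityMeasure
  -- Descending induction on `k`, vacuous at `d + 1`. Elements ahead of position `k` may move
  -- arbitrarily; they are handled at later stages.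
  suffices H : ∀ k, k ≤ d + 1 → 1 ≤ k →
      ∃ n, 0 < P (X n ⁻¹' {y | ∀ a b, k ≤ r.pos a → r.pos a < r.pos b → K ≤ y a - y b}) by
    obtain ⟨n, hn⟩ := H 1 (by omega) le_rfl
    exact ⟨n, by simpa only [r.one_le_pos, true_implies] using hn⟩
  intro k hkd
  induction hkd using Nat.decreasingInduction with
  | self =>
    refine fun _ => ⟨0, ?_⟩
    have h : {y : Fin d → ℝ | ∀ a b, d + 1 ≤ r.pos a → r.pos a < r.pos b → K ≤ y a - y b}
        = univ := by
      refine eq_univ_of_forall fun y a b ha => ?_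
      have := r.pos_le a
      omega
    rw [h]
    simp
  | of_succ k hkd ih =>
    intro hk
    obtain ⟨n, hn⟩ := ih (by omega)
    obtain ⟨ε, hε, hS⟩ := exists_gap_increasing_increments hpos hr hk (Nat.le_of_lt_succ hkd)
    -- Gaps behind position `k` are already large, and those from `k` fall short of `K` by at most
    -- `j * ε`. One favourable increment lowers `j` by one.
    let B : ℕ → Set (Fin d → ℝ) := fun j =>
      {y | (∀ a b, k + 1 ≤ r.pos a → r.pos a < r.pos b → K ≤ y a - y b) ∧
        ∀ a b, r.pos a = k → k < r.pos b → K - j * ε ≤ y a - y b}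
    have hBm : ∀ j, MeasurableSet (B j) := by
      intro j
      simp only [B, ofPred_and, ofPred_forall]
      refine MeasurableSet.inter ?_ ?_ <;>
      exact MeasurableSet.iInter fun a => MeasurableSet.iInter fun b =>
        MeasurableSet.iInter fun _ => MeasurableSet.iInter fun _ =>
          measurableSet_le measurable_const ((measurable_pi_apply a).sub (measurable_pi_apply b))
    have hstep : ∀ j n, 0 < P (X n ⁻¹' B j) → ∃ m, 0 < P (X m ⁻¹' B 0) := by
      intro j
      induction j with
      | zero => exact fun n h => ⟨n, h⟩
      | succ j ihj =>
        refine fun n h => ihj (n + 1) (hX.measure_succ_pos (hBm _) (hBm _) h fun y hy => ?_)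
        refine (hS (rk y)).trans_le (measure_mono fun z hz => ⟨fun a b ha hab => ?_,
          fun a b ha hb => ?_⟩)
        · have h1 := hy.1 a b ha hab
          have h2 := hz.1 a b (by omega) hab
          simp only [Pi.add_apply]
          linarith
        · have h1 := hy.2 a b ha hb
          have h2 := hz.2 a b ha hb
          push_cast at h1
          simp only [Pi.add_apply]
          linarith
    have hcover : {y : Fin d → ℝ | ∀ a b, k + 1 ≤ r.pos a → r.pos a < r.pos b → K ≤ y a - y b}
        ⊆ ⋃ j, B j := by
      intro y hy
      have hex : ∀ p : Fin d × Fin d, ∃ j : ℕ, K - (y p.1 - y p.2) ≤ j * ε := by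
        intro p
        obtain ⟨j, hj⟩ := Archimedean.arch (K - (y p.1 - y p.2)) hε
        exact ⟨j, by simpa using hj⟩
      choose f hf using hex
      obtain ⟨M, hM⟩ := Finite.exists_le f
      refine mem_iUnion.2 ⟨M, hy, fun a b _ _ => ?_⟩
      have h1 := hf (a, b)
      have h2 : (f (a, b) : ℝ) * ε ≤ M * ε := by
        have : (f (a, b) : ℝ) ≤ M := by exact_mod_cast hM (a, b)
        gcongr
      simp only at h1
      linarith
    have hj : ∃ j, 0 < P (X n ⁻¹' B j) := by
      by_contra! h
      refine (hn.trans_le (measure_mono (preimage_mono hcover))).ne' ?_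
      rw [preimage_iUnion]
      exact measure_iUnion_null fun j => nonpos_iff_eq_zero.1 (h j)
    obtain ⟨j, hj⟩ := hj
    obtain ⟨m, hm⟩ := hstep j n hj
    refine ⟨m, hm.trans_le (measure_mono (preimage_mono fun y hy a b ha hab => ?_))⟩
    rcases ha.eq_or_lt with h | h
    · simpa using hy.2 a b h.symm (by omega)
    · exact hy.1 a b h hab

/-! ### Conclusion. -/

theorem mainTheorem4 {d : ℕ} (μ : Ranking d → Measure (Fin d → ℝ))
    [∀ r, IsProbabilityMeasure (μ r)] (hμ : ∀ r, FiniteSecondMoments (μ r))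
    (hpos : ∀ (σ : Equiv.Perm (Fin d)) (r' : Ranking d), 0 < μ r' (leaderSet σ))
    (r : Ranking d) (hr : IsTerminal.{v} μ r)
    (ν : Measure (Fin d → ℝ)) [IsProbabilityMeasure ν] (hν : FiniteSecondMoments ν)
    {Ω : Type u} {mΩ : MeasurableSpace Ω} (P : Measure Ω) (𝓕 : Filtration ℕ mΩ)
    (X : ℕ → Ω → Fin d → ℝ) (hX : IsRankingBasedProcess μ ν P 𝓕 X) :
    0 < P (rankingConvergesTo X r) := by
  have hinj := hr.pos_injective hpos
  obtain ⟨x, hx⟩ := hr.exists_iInf_stayProb_pos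
  -- `K` bounds every gap of `x`, so each point of `G` dominates `x` in the sense of
  -- `stayProb_le_of_gaps_le`.
  obtain ⟨K, hK⟩ := Finite.exists_le fun p : Fin d × Fin d => x p.1 - x p.2
  obtain ⟨n, hn⟩ := hX.exists_measure_gaps_pos hpos hinj K
  set G : Set (Fin d → ℝ) := {y | ∀ a b, r.pos a < r.pos b → K ≤ y a - y b} with hG
  have hGm : MeasurableSet G := by
    simp only [hG, ofPred_forall]
    exact MeasurableSet.iInter fun a => MeasurableSet.iInter fun b =>
      MeasurableSet.iInter fun _ =>
        measurableSet_le measurable_const ((measurable_pi_apply a).sub (measurable_pi_apply b))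
  have hsub : X n ⁻¹' G ∩ {ω | ∀ m, n ≤ m → rk (X m ω) = r} ⊆ rankingConvergesTo X r :=
    fun ω hω => ⟨n, hω.2⟩
  refine lt_of_lt_of_le ?_ (measure_mono hsub)
  rw [hX.measure_inter_stay_forever r n (hX.adapted n hGm)]
  calc 0 < (⨅ N, stayProb μ r N x) * P (X n ⁻¹' G) := ENNReal.mul_pos hx.ne' hn.ne'
    _ = ∫⁻ _ in X n ⁻¹' G, ⨅ N, stayProb μ r N x ∂P := (setLIntegral_const _ _).symm
    _ ≤ ∫⁻ ω in X n ⁻¹' G, ⨅ N, stayProb μ r N (X n ω) ∂P :=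
      setLIntegral_mono' (hX.measurable n hGm) fun ω hω => iInf_mono fun N =>
        stayProb_le_of_gaps_le μ r hinj N fun a b hab => (hK (a, b)).trans (hω a b hab)
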